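/- Let $l^{2}=l^{2}(\mathbb{Z},\mathbb{C})$. Let $\widetilde H:l^{2}\to l^{2}$ be the discrete Hilbert transform, $(\widetilde H\mathbf a)_m=\frac1\pi\sum_{n\neq m}\frac{a_n}{m-n}$ for $m\in\mathbb{Z}$, which is a bounded operator; put $H=\pi\widetilde H$, and for $t\in\mathbb{R}$ let $e^{tH}=\sum_{j\ge 0}\frac{t^{j}}{j!}H^{j}$. Let $\operatorname{sinc}x=\frac{\sin \pi x}{\pi x}$ for $x\neq0$ and $\operatorname{sinc}0=1$. For $s\in\mathbb{N}=\{1,2,\dots\}$ and $k\in\mathbb{Z}$ put $$A_{s,k}=(-1)^{k+1}\operatorname{sinc}^{(2s-1)}\left(\tfrac12-k\right),$$ $$B_{s,k}=(-1)^{k+1}\operatorname{sinc}^{(2s)}(-k)\ \ (k\neq0),\qquad B_{s,0}=(-1)^{s+1}\frac{\pi^{2s}}{2s+1},$$ and for $\mathbf a\in l^{2}$ put $$\mathcal R^{(2s-1)}_{H}\mathbf a=\sum_{k\in\mathbb{Z}}(-1)^{k+1}A_{s,k}\,e^{(k-1/2)H}\mathbf a,\qquad \mathcal R^{(2s)}_{H}\mathbf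 a=\sum_{k\in\mathbb{Z}}(-1)^{k+1}B_{s,k}\,e^{kH}\mathbf a .$$ Theorem. For every $\mathbf a\in l^{2}$ and every $s\in\mathbb{N}$ both series converge (unconditionally) in the norm of $l^{2}$, and $$H^{2s-1}\mathbf a=\sum_{k\in\mathbb{Z}}(-1)^{k+1}A_{s,k}\,e^{(k-1/2)H}\mathbf a,\qquad H^{2s}\mathbf a=\sum_{k\in\mathbb{Z}}(-1)^{k+1}B_{s,k}\,e^{kH}\mathbf a .$$ Thus $H^{r}\mathbf a=\mathcal R^{(r)}_{H}\mathbf a$ for every $r\in\mathbb{N}$. Moreover, with $\mathcal R_H=\mathcal R_H^{(1)}$, $$H^{r}\mathbf a=\mathcal R_H^{(r)}\mathbf a=\mathcal R_H^{r}\mathbf a=\underbrace{\mathcal R_H(\cdots(\mathcal R_H}_{r\text{ times}}\mathbf a)\cdots)\qquad\text{for every } r\in\mathbb{N},\ \mathbf a\in l^{2}.$$ -/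

import Mathlib

open scoped ENNReal

noncomputable section

namespace DiscreteHilbert

/-- The complex Hilbert space `l²` of two-sided square-summable sequences. -/
abbrev SeqL2 : Type := lp (fun _ : ℤ => ℂ) 2

/-! ### The discrete Hilbert transform -/

/-- The `m`-th entry `(1/π) ∑_{n ≠ m} a n / (m - n)` of the discrete Hilbert transform of `a`. -/
def hilbertEntry (a : ℤ → ℂ) (m : ℤ) : ℂ :=
  (1 / (Real.pi : ℂ)) * ∑' n : ℤ, if n = m then 0 else a n / ((m : ℂ) - (n : ℂ))

/-- The sawtooth `x ↦ -2πi (x - 1/2)` on the circle, as a bounded function: its `k`-th Fourier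
coefficient is `1 / k` for `k ≠ 0`, and `0` for `k = 0`. -/
theorem exists_sawtooth :
    ∃ G : MeasureTheory.Lp ℂ ∞ (AddCircle.haarAddCircle (T := (1 : ℝ))),
      ∀ k : ℤ, fourierCoeff (T := (1 : ℝ)) G k = 1 / (k : ℂ) := by
  set g : AddCircle (1 : ℝ) → ℂ :=
    fun x => (-(2 * Real.pi * Complex.I)) * (((↑) : ℝ → ℂ) ∘ periodizedBernoulli 1) x with hg
  have hmeas : Measurable (periodizedBernoulli 1) := by
    have h1 : Measurable (fun y : AddCircle (1 : ℝ) =>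
        bernoulliFun 1 ((AddCircle.measurableEquivIco 1 0 y : Set.Ico (0 : ℝ) (0 + 1)) : ℝ)) :=
      (continuous_bernoulliFun 1).measurable.comp
        (measurable_subtype_coe.comp (AddCircle.measurableEquivIco 1 0).measurable)
    exact h1
  have hbdd : ∀ y, ‖periodizedBernoulli 1 y‖ ≤ 1 := by
    intro y
    have hy := (AddCircle.equivIco 1 0 y).2
    have : periodizedBernoulli 1 y = bernoulliFun 1 (AddCircle.equivIco 1 0 y : ℝ) := rfl
    rw [this, bernoulliFun_one, Real.norm_eq_abs, abs_le]
    constructor <;> linarith [hy.1, hy.2]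
  have hmem : MeasureTheory.MemLp g ∞ (AddCircle.haarAddCircle (T := (1 : ℝ))) := by
    refine MeasureTheory.memLp_top_of_bound (C := ‖(-(2 * Real.pi * Complex.I))‖ * 1) ?_ ?_
    · exact ((Complex.measurable_ofReal.comp hmeas).const_mul _).aestronglyMeasurable
    · refine Filter.Eventually.of_forall fun y => ?_
      rw [hg, norm_mul]
      gcongr
      simpa using hbdd y
  refine ⟨hmem.toLp g, fun k => ?_⟩
  rw [fourierCoeff_congr_ae hmem.coeFn_toLp, hg, fourierCoeff.const_mul,
    fourierCoeff_bernoulli_eq one_ne_zero]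
  by_cases hk : k = 0
  · simp [hk]
  · have : (k : ℂ) ≠ 0 := by exact_mod_cast hk
    have h2 : (Real.pi : ℂ) ≠ 0 := by exact_mod_cast Real.pi_ne_zero
    have h3 := Complex.I_ne_zero
    simp only [Nat.factorial_one, Nat.cast_one, pow_one]
    field_simp

/-- The matrix `1 / (m - n)`, `m ≠ n`, defines a bounded operator on `l²`. -/
theorem exists_hilbertOperator :
    ∃ T : SeqL2 →L[ℂ] SeqL2, ∀ (a : SeqL2) (m : ℤ),
      HasSum (fun n : ℤ => if n = m then 0 else a n / ((m : ℂ) - (n : ℂ))) (T a m) := by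
  obtain ⟨G, hG⟩ := exists_sawtooth
  let b := fourierBasis (T := (1 : ℝ))
  let M : MeasureTheory.Lp ℂ 2 (AddCircle.haarAddCircle (T := (1 : ℝ))) →L[ℂ]
      MeasureTheory.Lp ℂ 2 (AddCircle.haarAddCircle (T := (1 : ℝ))) :=
    (ContinuousLinearMap.lsmul ℂ ℂ : ℂ →L[ℂ] ℂ →L[ℂ] ℂ).holderL AddCircle.haarAddCircle ∞ 2 2 G
  refine ⟨b.repr.toContinuousLinearEquiv.toContinuousLinearMap ∘L M ∘L
    b.repr.symm.toContinuousLinearEquiv.toContinuousLinearMap, fun a m => ?_⟩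
  have hs := b.hasSum_repr_symm a
  let ev : MeasureTheory.Lp ℂ 2 (AddCircle.haarAddCircle (T := (1 : ℝ))) →L[ℂ] ℂ :=
    innerSL ℂ (b m) ∘L M
  have hs' := ev.hasSum hs
  have e1 : ∀ f, ev f = b.repr (M f) m := by
    intro f
    simp [ev, b.repr_apply_apply]
  have e2 : ∀ n, ev (a n • b n) = if n = m then 0 else a n / ((m : ℂ) - (n : ℂ)) := by
    intro n
    rw [map_smul, e1, fourierBasis_repr, coe_fourierBasis]
    have : fourierCoeff (T := (1 : ℝ)) (M (fourierLp 2 n)) m = fourierCoeff (T := (1 : ℝ)) G (m - n) := by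
      unfold fourierCoeff
      refine MeasureTheory.integral_congr_ae ?_
      have h1 := ContinuousLinearMap.coeFn_holder (r := 2)
        (ContinuousLinearMap.lsmul ℂ ℂ : ℂ →L[ℂ] ℂ →L[ℂ] ℂ) G (fourierLp (T := (1 : ℝ)) 2 n)
      have h2 := coeFn_fourierLp (T := (1 : ℝ)) 2 n
      filter_upwards [h1, h2] with x hx1 hx2
      have : (M (fourierLp 2 n)) x = G x * fourier n x := by
        rw [← hx2]; exact hx1
      rw [this, show -(m - n) = -m + n by ring, fourier_add, smul_eq_mul, smul_eq_mul]
      ring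
    rw [this, hG, smul_eq_mul]
    split_ifs with h
    · simp [h]
    · push_cast; ring
  have e3 : (fun n => ev (a n • b n))
      = fun n : ℤ => if n = m then 0 else a n / ((m : ℂ) - (n : ℂ)) := funext e2
  have hs'' : HasSum (fun n => ev (a n • b n)) (ev (b.repr.symm a)) := hs'
  rw [e3, e1] at hs''
  exact hs''

theorem exists_hilbertEntry_eq :
    ∃ T : SeqL2 →L[ℂ] SeqL2, ∀ (a : SeqL2) (m : ℤ), hilbertEntry a m = T a m := by
  obtain ⟨T, hT⟩ := exists_hilbertOperator
  refine ⟨(1 / (Real.pi : ℂ)) • T, fun a m => ?_⟩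
  rw [hilbertEntry, (hT a m).tsum_eq]
  rfl

/-- The discrete Hilbert transform as a bounded operator on `l²`,
`(a_n) ↦ ((1/π) ∑_{n ≠ m} a_n / (m - n))_m`. -/
def discreteHilbertTransform : SeqL2 →L[ℂ] SeqL2 :=
  LinearMap.mkContinuousOfExistsBound
    { toFun := fun a => ⟨hilbertEntry a, by
        obtain ⟨T, hT⟩ := exists_hilbertEntry_eq
        rw [show hilbertEntry a = ⇑(T a) from funext (hT a)]
        exact lp.memℓp _⟩
      map_add' := fun a a' => by
        obtain ⟨T, hT⟩ := exists_hilbertEntry_eq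
        ext m
        change hilbertEntry ⇑(a + a') m = hilbertEntry ⇑a m + hilbertEntry ⇑a' m
        rw [hT, hT, hT, map_add]
        rfl
      map_smul' := fun c a => by
        obtain ⟨T, hT⟩ := exists_hilbertEntry_eq
        ext m
        change hilbertEntry ⇑(c • a) m = c * hilbertEntry ⇑a m
        rw [hT, hT, map_smul]
        rfl }
    (by
      obtain ⟨T, hT⟩ := exists_hilbertEntry_eq
      refine ⟨‖T‖, fun a => le_trans (le_of_eq ?_) (T.le_opNorm a)⟩
      congr 1
      ext m
      exact hT a m)

theorem discreteHilbertTransform_apply (a : SeqL2) (m : ℤ) :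
    discreteHilbertTransform a m =
      (1 / (Real.pi : ℂ)) * ∑' n : ℤ, if n = m then 0 else a n / ((m : ℂ) - (n : ℂ)) := rfl

/-- `H`, which is `π` times the discrete Hilbert transform. -/
def H : SeqL2 →L[ℂ] SeqL2 := (Real.pi : ℂ) • discreteHilbertTransform

/-- The one-parameter group `e^{tH}`, the sum of the exponential series of the bounded operator
`tH`. -/
def expH (t : ℝ) : SeqL2 →L[ℂ] SeqL2 := NormedSpace.exp ((t : ℂ) • H)

/-! ### The coefficients and the Boas-type series -/

/-- The normalized cardinal sine, `sin (π x) / (π x)` with value `1` at `0`. -/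
def nsinc (x : ℝ) : ℝ := if x = 0 then 1 else Real.sin (Real.pi * x) / (Real.pi * x)

/-- `A_{s,k} = (-1)^{k+1} sinc^{(2s-1)}(1/2 - k)` for `s ≥ 1`. -/
def coeffA (s : ℕ) (k : ℤ) : ℝ :=
  (-1 : ℝ) ^ (k + 1) * iteratedDeriv (2 * s - 1) nsinc (1 / 2 - (k : ℝ))

/-- `B_{s,k} = (-1)^{k+1} sinc^{(2s)}(-k)` for `k ≠ 0`, and
`B_{s,0} = (-1)^{s+1} π^{2s} / (2s+1)`. -/
def coeffB (s : ℕ) (k : ℤ) : ℝ :=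
  if k = 0 then (-1 : ℝ) ^ (s + 1) * (Real.pi ^ (2 * s) / (2 * (s : ℝ) + 1))
  else (-1 : ℝ) ^ (k + 1) * iteratedDeriv (2 * s) nsinc (-(k : ℝ))

/-- The `k`-th term of the series of odd order `2s - 1`. -/
def oddTerm (s : ℕ) (a : SeqL2) (k : ℤ) : SeqL2 :=
  (((-1 : ℝ) ^ (k + 1) * coeffA s k : ℝ) : ℂ) • expH ((k : ℝ) - 1 / 2) a

/-- The `k`-th term of the series of even order `2s`. -/
def evenTerm (s : ℕ) (a : SeqL2) (k : ℤ) : SeqL2 :=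
  (((-1 : ℝ) ^ (k + 1) * coeffB s k : ℝ) : ℂ) • expH (k : ℝ) a

/-- `𝓡_H^{(r)} a` for `r ≥ 1`: the series of odd order if `r = 2s - 1`, and the series of even
order if `r = 2s`; the sums are taken in the norm of `l²`. -/
def boasR (r : ℕ) (a : SeqL2) : SeqL2 :=
  if Odd r then ∑' k : ℤ, oddTerm ((r + 1) / 2) a k else ∑' k : ℤ, evenTerm (r / 2) a k

end DiscreteHilbert

end

noncomputable section

namespace DiscreteHilbert

/-! ### The operator `H`: norm bound, skew-adjointness, spectrum -/

/-! On the Fourier side `H` is multiplication by a sawtooth of sup norm at most `π`, and its matrix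
is real and antisymmetric. Hence `‖H‖ ≤ π` and `H` is skew-adjoint, so its spectrum lies in `i[-π,
π]` (`exists_of_mem_spectrum_H`). By the continuous functional calculus it then suffices to prove
the scalar identity `(iθ)^n e^{icθ} = ∑ sinc^{(n)}(c - k) e^{ikθ}`, uniformly for `|θ| ≤ π`, and to
multiply the resulting operator identity by `e^{-cH}` (`hasSum_expH`). Since `sinc` is the Fourier
transform of the indicator of `(-1/2, 1/2]`, the number `sinc^{(n)}(c - k)` is the `k`-th Fourier
coefficient of the left side (`fourierCoeff_liftIco_symbol`). With `c = 1/2` for odd `n` and `c = 0`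
for even `n`, the left side takes equal values at `θ = ±π`, so its coefficients are `O(1/k²)` and
the series converges absolutely. Every `boasR r` is therefore `H ^ r`, which gives the iteration
formula. -/

/-- The sawtooth of `exists_sawtooth`, with the bound `π` on its essential supremum. -/
theorem exists_sawtooth_norm_le :
    ∃ G : MeasureTheory.Lp ℂ ∞ (AddCircle.haarAddCircle (T := (1 : ℝ))),
      ‖G‖ ≤ Real.pi ∧ ∀ k : ℤ, fourierCoeff (T := (1 : ℝ)) G k = 1 / (k : ℂ) := by
  set g : AddCircle (1 : ℝ) → ℂ :=
    fun x => (-(2 * Real.pi * Complex.I)) * (((↑) : ℝ → ℂ) ∘ periodizedBernoulli 1) x with hg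
  have hmeas : Measurable (periodizedBernoulli 1) := by
    have h1 : Measurable (fun y : AddCircle (1 : ℝ) =>
        bernoulliFun 1 ((AddCircle.measurableEquivIco 1 0 y : Set.Ico (0 : ℝ) (0 + 1)) : ℝ)) :=
      (continuous_bernoulliFun 1).measurable.comp
        (measurable_subtype_coe.comp (AddCircle.measurableEquivIco 1 0).measurable)
    exact h1
  -- The bound `1/2` for `x - 1/2` on `[0, 1)`, times `|-2πi|`, gives exactly `π`; a larger constant
  -- would let the spectrum exceed one period.
  have hbdd : ∀ y, ‖periodizedBernoulli 1 y‖ ≤ 1 / 2 := by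
    intro y
    have hy := (AddCircle.equivIco 1 0 y).2
    have : periodizedBernoulli 1 y = bernoulliFun 1 (AddCircle.equivIco 1 0 y : ℝ) := rfl
    rw [this, bernoulliFun_one, Real.norm_eq_abs, abs_le]
    constructor <;> linarith [hy.1, hy.2]
  have hgb : ∀ y, ‖g y‖ ≤ Real.pi := by
    intro y
    have h1 : ‖g y‖ = 2 * Real.pi * ‖periodizedBernoulli 1 y‖ := by
      rw [hg, norm_mul]
      simp [abs_of_pos Real.pi_pos]
    rw [h1]
    nlinarith [hbdd y, Real.pi_pos]
  have hmem : MeasureTheory.MemLp g ∞ (AddCircle.haarAddCircle (T := (1 : ℝ))) :=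
    MeasureTheory.memLp_top_of_bound
      ((Complex.measurable_ofReal.comp hmeas).const_mul _).aestronglyMeasurable
      Real.pi (Filter.Eventually.of_forall hgb)
  refine ⟨hmem.toLp g, ?_, fun k => ?_⟩
  · rw [MeasureTheory.Lp.norm_toLp]
    refine ENNReal.toReal_le_of_le_ofReal Real.pi_pos.le ?_
    rw [MeasureTheory.eLpNorm_exponent_top]
    exact MeasureTheory.eLpNormEssSup_le_of_ae_bound (Filter.Eventually.of_forall hgb)
  · rw [fourierCoeff_congr_ae hmem.coeFn_toLp, hg, fourierCoeff.const_mul,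
      fourierCoeff_bernoulli_eq one_ne_zero]
    by_cases hk : k = 0
    · simp [hk]
    · have : (k : ℂ) ≠ 0 := by exact_mod_cast hk
      have h2 : (Real.pi : ℂ) ≠ 0 := by exact_mod_cast Real.pi_ne_zero
      have h3 := Complex.I_ne_zero
      simp only [Nat.factorial_one, Nat.cast_one, pow_one]
      field_simp

/-- A bounded symbol `G` on the circle gives a bounded Toeplitz operator on `l²(ℤ)`, with matrix
the Fourier coefficients of `G` and norm at most `‖G‖_∞`. -/
theorem exists_laurentOperator
    (G : MeasureTheory.Lp ℂ ∞ (AddCircle.haarAddCircle (T := (1 : ℝ)))) :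
    ∃ T : SeqL2 →L[ℂ] SeqL2, ‖T‖ ≤ ‖G‖ ∧ ∀ (a : SeqL2) (m : ℤ),
      HasSum (fun n : ℤ => a n * fourierCoeff (T := (1 : ℝ)) G (m - n)) (T a m) := by
  let b := fourierBasis (T := (1 : ℝ))
  let M : MeasureTheory.Lp ℂ 2 (AddCircle.haarAddCircle (T := (1 : ℝ))) →L[ℂ]
      MeasureTheory.Lp ℂ 2 (AddCircle.haarAddCircle (T := (1 : ℝ))) :=
    (ContinuousLinearMap.lsmul ℂ ℂ : ℂ →L[ℂ] ℂ →L[ℂ] ℂ).holderL AddCircle.haarAddCircle ∞ 2 2 G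
  have hM : ∀ f, ‖M f‖ ≤ ‖G‖ * ‖f‖ := by
    intro f
    refine ((ContinuousLinearMap.lsmul ℂ ℂ : ℂ →L[ℂ] ℂ →L[ℂ] ℂ).norm_holder_apply_apply_le
      (r := 2) G f).trans ?_
    have h1 : ‖(ContinuousLinearMap.lsmul ℂ ℂ : ℂ →L[ℂ] ℂ →L[ℂ] ℂ)‖ ≤ 1 :=
      ContinuousLinearMap.opNorm_lsmul_le
    gcongr
    exact mul_le_of_le_one_left (norm_nonneg _) h1
  refine ⟨b.repr.toContinuousLinearEquiv.toContinuousLinearMap ∘L M ∘L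
    b.repr.symm.toContinuousLinearEquiv.toContinuousLinearMap, ?_, fun a m => ?_⟩
  · refine ContinuousLinearMap.opNorm_le_bound _ (norm_nonneg _) fun a => ?_
    have h1 : ‖b.repr (M (b.repr.symm a))‖ ≤ ‖G‖ * ‖a‖ := by
      rw [LinearIsometryEquiv.norm_map]
      simpa only [LinearIsometryEquiv.norm_map] using hM (b.repr.symm a)
    exact h1
  have hs := b.hasSum_repr_symm a
  let ev : MeasureTheory.Lp ℂ 2 (AddCircle.haarAddCircle (T := (1 : ℝ))) →L[ℂ] ℂ :=
    innerSL ℂ (b m) ∘L M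
  have hs' := ev.hasSum hs
  have e1 : ∀ f, ev f = b.repr (M f) m := by
    intro f
    simp [ev, b.repr_apply_apply]
  have e2 : ∀ n, ev (a n • b n) = a n * fourierCoeff (T := (1 : ℝ)) G (m - n) := by
    intro n
    rw [map_smul, e1, fourierBasis_repr, coe_fourierBasis, smul_eq_mul]
    congr 1
    unfold fourierCoeff
    refine MeasureTheory.integral_congr_ae ?_
    have h1 := ContinuousLinearMap.coeFn_holder (r := 2)
      (ContinuousLinearMap.lsmul ℂ ℂ : ℂ →L[ℂ] ℂ →L[ℂ] ℂ) G (fourierLp (T := (1 : ℝ)) 2 n)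
    have h2 := coeFn_fourierLp (T := (1 : ℝ)) 2 n
    filter_upwards [h1, h2] with x hx1 hx2
    have : (M (fourierLp 2 n)) x = G x * fourier n x := by
      rw [← hx2]; exact hx1
    rw [this, show -(m - n) = -m + n by ring, fourier_add, smul_eq_mul, smul_eq_mul]
    ring
  have hs'' : HasSum (fun n => ev (a n • b n)) (ev (b.repr.symm a)) := hs'
  rw [funext e2, e1] at hs''
  exact hs''

theorem exists_hilbertOperator_norm_le :
    ∃ T : SeqL2 →L[ℂ] SeqL2, ‖T‖ ≤ Real.pi ∧ ∀ (a : SeqL2) (m : ℤ),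
      HasSum (fun n : ℤ => if n = m then 0 else a n / ((m : ℂ) - (n : ℂ))) (T a m) := by
  obtain ⟨G, hGn, hG⟩ := exists_sawtooth_norm_le
  obtain ⟨T, hTn, hT⟩ := exists_laurentOperator G
  refine ⟨T, hTn.trans hGn, fun a m => ?_⟩
  convert hT a m using 2 with n
  rw [hG]
  split_ifs with h
  · simp [h]
  · push_cast; ring

theorem H_apply (a : SeqL2) (m : ℤ) :
    H a m = ∑' n : ℤ, if n = m then 0 else a n / ((m : ℂ) - (n : ℂ)) := by
  have h : H a m = (Real.pi : ℂ) * discreteHilbertTransform a m := rfl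
  have hpi : (Real.pi : ℂ) ≠ 0 := by exact_mod_cast Real.pi_ne_zero
  rw [h, discreteHilbertTransform_apply, ← mul_assoc, mul_one_div_cancel hpi, one_mul]

theorem hasSum_H_apply (a : SeqL2) (m : ℤ) :
    HasSum (fun n : ℤ => if n = m then 0 else a n / ((m : ℂ) - (n : ℂ))) (H a m) := by
  obtain ⟨T, hT⟩ := exists_hilbertOperator
  rw [H_apply]
  exact (hT a m).summable.hasSum

theorem norm_H_le : ‖H‖ ≤ Real.pi := by
  obtain ⟨T, hTn, hT⟩ := exists_hilbertOperator_norm_le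
  have : H = T := by
    ext a m
    exact (hasSum_H_apply a m).unique (hT a m)
  rwa [this]

/-- The matrix `1 / (m - n)` is real and antisymmetric; the entries of the adjoint are read off by
pairing with unit vectors. -/
theorem star_H : star H = -H := by
  ext a m
  rw [ContinuousLinearMap.star_eq_adjoint]
  have h1 : (ContinuousLinearMap.adjoint H a) m
      = inner ℂ (lp.single 2 m (1 : ℂ) : SeqL2) (ContinuousLinearMap.adjoint H a) := by
    rw [lp.inner_single_left]; simp
  have hentry : ∀ n : ℤ, H (lp.single 2 m (1 : ℂ) : SeqL2) n
      = if n = m then 0 else 1 / ((n : ℂ) - (m : ℂ)) := by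
    intro n
    refine (hasSum_H_apply _ n).unique ?_
    convert hasSum_ite_eq m (if n = m then (0 : ℂ) else 1 / ((n : ℂ) - (m : ℂ))) using 2 with k
    rw [lp.single_apply]
    by_cases hk : k = m
    · subst hk; simp [eq_comm]
    · simp [hk]
  have h2 := (lp.hasSum_inner (𝕜 := ℂ) (H (lp.single 2 m (1 : ℂ) : SeqL2)) a)
  rw [h1, ContinuousLinearMap.adjoint_inner_right]
  refine h2.unique ?_
  have h3 := (hasSum_H_apply a m).neg
  refine (Eq.subst (motive := fun f => HasSum f (-(H a m))) ?_ h3)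
  funext n
  rw [hentry]
  by_cases hn : n = m
  · simp [hn]
  · simp only [hn, if_false, RCLike.inner_apply, map_div₀, map_one, map_sub, map_intCast]
    rw [← neg_sub (n : ℂ) (m : ℂ), div_neg, neg_neg]
    ring

instance isStarNormal_H : IsStarNormal H := ⟨by rw [star_H]; exact (Commute.refl H).neg_left⟩

/-- `iH` is self-adjoint, so its spectrum is real; the size of the imaginary part comes from
`norm_H_le`. -/
theorem exists_of_mem_spectrum_H {z : ℂ} (hz : z ∈ spectrum ℂ H) :
    z.re = 0 ∧ |z.im| ≤ Real.pi := by
  have hsa : IsSelfAdjoint (Complex.I • H) := by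
    rw [IsSelfAdjoint, star_smul, star_H]; simp
  have hmem : Complex.I * z ∈ spectrum ℂ (Complex.I • H) := by
    have := (spectrum.smul_mem_smul_iff (R := ℂ) (a := H) (s := z)
      (r := Units.mk0 Complex.I Complex.I_ne_zero)).2 hz
    exact this
  have h1 := hsa.im_eq_zero_of_mem_spectrum hmem
  refine ⟨by simpa using h1, ?_⟩
  calc |z.im| ≤ ‖z‖ := Complex.abs_im_le_norm z
    _ ≤ ‖H‖ * ‖(1 : SeqL2 →L[ℂ] SeqL2)‖ := spectrum.norm_le_norm_mul_of_mem hz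
    _ ≤ ‖H‖ := mul_le_of_le_one_right (norm_nonneg _) ContinuousLinearMap.norm_id_le
    _ ≤ Real.pi := norm_H_le

/-! ### Derivatives of the cardinal sine as Fourier coefficients -/

open FourierTransform

/-- The indicator function of `(-1/2, 1/2]`. -/
def box : ℝ → ℂ := Set.indicator (Set.Ioc (-(1 / 2) : ℝ) (1 / 2)) (fun _ => (1 : ℂ))

theorem fourier_mul_box (g : ℝ → ℂ) (w : ℝ) :
    𝓕 (fun v => g v • box v) w =
      ∫ v in (-(1 / 2) : ℝ)..(1 / 2), Complex.exp (-2 * Real.pi * Complex.I * w * v) * g v := by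
  rw [Real.fourier_real_eq_integral_exp_smul, intervalIntegral.integral_of_le (by norm_num),
    ← MeasureTheory.integral_indicator measurableSet_Ioc]
  congr 1
  funext v
  by_cases hv : v ∈ Set.Ioc (-(1 / 2) : ℝ) (1 / 2)
  · rw [box, Set.indicator_of_mem hv, Set.indicator_of_mem hv]
    simp only [smul_eq_mul, mul_one]
    congr 2
    push_cast; ring
  · rw [box, Set.indicator_of_notMem hv, Set.indicator_of_notMem hv]
    simp

theorem fourier_box : 𝓕 box = fun x : ℝ => (nsinc x : ℂ) := by
  funext w
  have h := fourier_mul_box (fun _ => 1) w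
  simp only [one_smul, mul_one] at h
  refine h.trans ?_
  by_cases hw : w = 0
  · subst hw
    simp [nsinc]
    norm_num
  have hw' : (w : ℂ) ≠ 0 := by exact_mod_cast hw
  have hpi : (Real.pi : ℂ) ≠ 0 := by exact_mod_cast Real.pi_ne_zero
  have hI := Complex.I_ne_zero
  rw [integral_exp_mul_complex (by simp [hw', hpi]), nsinc, if_neg hw]
  push_cast
  rw [Complex.sin,
    show -2 * (Real.pi : ℂ) * Complex.I * w * (1 / 2) = -(Real.pi * w) * Complex.I by ring,
    show -2 * (Real.pi : ℂ) * Complex.I * w * (-(1 / 2)) = Real.pi * w * Complex.I by ring]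
  field_simp
  rw [Complex.I_sq]
  ring

theorem integrable_pow_smul_box (n : ℕ) :
    MeasureTheory.Integrable (fun v : ℝ => v ^ n • box v) := by
  have h : (fun v : ℝ => v ^ n • box v)
      = Set.indicator (Set.Ioc (-(1 / 2) : ℝ) (1 / 2)) (fun v => ((v ^ n : ℝ) : ℂ)) := by
    funext v
    by_cases hv : v ∈ Set.Ioc (-(1 / 2) : ℝ) (1 / 2)
    · rw [box, Set.indicator_of_mem hv, Set.indicator_of_mem hv]; simp
    · rw [box, Set.indicator_of_notMem hv, Set.indicator_of_notMem hv]; simp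
  rw [h, MeasureTheory.integrable_indicator_iff measurableSet_Ioc]
  exact ((Complex.continuous_ofReal.comp (continuous_pow n)).integrableOn_Icc).mono_set
    Set.Ioc_subset_Icc_self

/-- All moments of `box` are integrable, so its Fourier transform may be differentiated any number
of times. -/
theorem contDiff_nsinc (n : ℕ) : ContDiff ℝ n nsinc := by
  have h : ContDiff ℝ ((n : ℕ∞) : WithTop ℕ∞) (𝓕 box) := by
    refine Real.contDiff_fourier fun k _ => ?_
    simpa [norm_smul] using (integrable_pow_smul_box k).norm
  rw [fourier_box] at h
  exact Complex.reCLM.contDiff.comp h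

theorem ofReal_iteratedDeriv_nsinc (n : ℕ) (x : ℝ) :
    ((iteratedDeriv n nsinc x : ℝ) : ℂ) =
      ∫ u in (-(1 / 2) : ℝ)..(1 / 2),
        (2 * Real.pi * Complex.I * u) ^ n * Complex.exp (2 * Real.pi * Complex.I * x * u) := by
  have h1 : ((iteratedDeriv n nsinc x : ℝ) : ℂ)
      = iteratedDeriv n (fun y : ℝ => (nsinc y : ℂ)) x := by
    have := Complex.ofRealCLM.iteratedFDeriv_comp_left (contDiff_nsinc n).contDiffAt le_rfl (x := x)
    rw [iteratedDeriv_eq_iteratedFDeriv, iteratedDeriv_eq_iteratedFDeriv]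
    change _ = iteratedFDeriv ℝ n (Complex.ofRealCLM ∘ nsinc) x _
    rw [this]
    rfl
  rw [h1, ← fourier_box, Real.iteratedDeriv_fourier (N := n)
    (fun k _ => integrable_pow_smul_box k) le_rfl, fourier_mul_box]
  -- The Fourier kernel carries `-2πi`; reflecting `u` over the symmetric interval restores the sign
  -- `+2πi`.
  have h2 := intervalIntegral.integral_comp_neg (a := -(1 / 2)) (b := 1 / 2) fun u : ℝ =>
    (2 * Real.pi * Complex.I * u) ^ n * Complex.exp (2 * Real.pi * Complex.I * x * u)
  rw [neg_neg] at h2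
  rw [← h2]
  congr 1
  funext u
  rw [mul_comm]
  push_cast
  congr 2 <;> ring

/-- The symbol `(iθ)^n e^{icθ}`, `θ = 2πu`. -/
def symbol (n : ℕ) (c : ℝ) (u : ℝ) : ℂ :=
  (2 * Real.pi * Complex.I * u) ^ n * Complex.exp (2 * Real.pi * Complex.I * c * u)

theorem contDiff_symbol (n : ℕ) (c : ℝ) {m : WithTop ℕ∞} : ContDiff ℝ m (symbol n c) := by
  have h : ContDiff ℝ m (fun u : ℝ => (u : ℂ)) := Complex.ofRealCLM.contDiff
  exact ((contDiff_const.mul h).pow n).mul (contDiff_const.mul h).cexp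

theorem fourierCoeff_liftIco_symbol (n : ℕ) (c : ℝ) (k : ℤ) :
    fourierCoeff (AddCircle.liftIco (1 : ℝ) (-(1 / 2)) (symbol n c)) k
      = ((iteratedDeriv n nsinc (c - k) : ℝ) : ℂ) := by
  rw [fourierCoeff_liftIco_eq, fourierCoeffOn_eq_integral, ofReal_iteratedDeriv_nsinc]
  rw [show (1 / (-(1 / 2) + 1 - -(1 / 2)) : ℝ) = 1 by norm_num, one_smul,
    show (-(1 / 2) + 1 : ℝ) = 1 / 2 by norm_num]
  congr 1
  funext u
  rw [fourier_coe_apply, symbol, smul_eq_mul, mul_left_comm, ← Complex.exp_add]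
  congr 2
  push_cast
  ring

/-- Two integrations by parts give decay `1/n²`. Equal endpoint values remove the boundary term of
the first; that of the second involves `deriv f` and need only be bounded. -/
theorem summable_fourierCoeffOn_of_contDiff {a b : ℝ} (hab : a < b) {f : ℝ → ℂ}
    (hf : ContDiff ℝ 2 f) (hper : f a = f b) : Summable (fourierCoeffOn hab f) := by
  have hd1 : ContDiff ℝ 1 (deriv f) := by
    have h2 : ContDiff ℝ (1 + 1) f := hf.of_le (by norm_num)
    exact (contDiff_succ_iff_deriv.1 h2).2.2
  have hc2 : Continuous (deriv (deriv f)) := hd1.continuous_deriv le_rfl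
  obtain ⟨C, hC⟩ := isCompact_Icc.exists_bound_of_continuousOn (s := Set.Icc a b)
    hc2.continuousOn
  have hbd : ∀ n : ℤ, ‖fourierCoeffOn hab (deriv (deriv f)) n‖ ≤ C := by
    intro n
    rw [fourierCoeffOn_eq_integral, norm_smul]
    have hpos : 0 < b - a := by linarith
    have h1 : ‖∫ x in a..b, fourier (-n) (x : AddCircle (b - a)) • deriv (deriv f) x‖
        ≤ C * |b - a| := by
      refine intervalIntegral.norm_integral_le_of_norm_le_const fun x hx => ?_
      rw [Set.uIoc_of_le hab.le] at hx
      rw [norm_smul, fourier_apply, Circle.norm_coe, one_mul]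
      exact hC x (Set.Ioc_subset_Icc_self hx)
    calc _ ≤ ‖1 / (b - a)‖ * (C * |b - a|) := by gcongr
      _ = C := by
        rw [Real.norm_eq_abs, abs_div, abs_of_pos hpos, abs_one]; field_simp
  have hpos : 0 < b - a := by linarith
  have hfd : ∀ x ∈ Set.uIcc a b, HasDerivAt f (deriv f x) x := fun x _ =>
    (hf.differentiable (by norm_num) x).hasDerivAt
  have hfd' : ∀ x ∈ Set.uIcc a b, HasDerivAt (deriv f) (deriv (deriv f) x) x := fun x _ =>
    (hd1.differentiable (by norm_num) x).hasDerivAt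
  set D : ℝ := (b - a) * (‖deriv f b - deriv f a‖ + (b - a) * C)
  have hsum : Summable fun n : ℤ => D * (1 / (n : ℝ) ^ 2) :=
    (Real.summable_one_div_int_pow.2 (by norm_num)).mul_left D
  refine Summable.of_norm_bounded_eventually hsum ?_
  have hne : ∀ᶠ n : ℤ in Filter.cofinite, n ≠ 0 := by
    simpa using (Set.finite_singleton (0 : ℤ)).compl_mem_cofinite
  filter_upwards [hne] with n hn
  have hn' : (0 : ℝ) < |(n : ℝ)| := abs_pos.2 (by exact_mod_cast hn)
  have hC0 : 0 ≤ C := (norm_nonneg _).trans (hbd 0)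
  have hba : ‖(b : ℂ) - a‖ = b - a := by
    rw [← Complex.ofReal_sub, Complex.norm_real, Real.norm_of_nonneg hpos.le]
  have hfac : ‖(1 : ℂ) / (-2 * Real.pi * Complex.I * n)‖ ≤ 1 / |(n : ℝ)| := by
    rw [norm_div, norm_one]
    refine one_div_le_one_div_of_le hn' ?_
    simp only [norm_mul, norm_neg, Complex.norm_I, Complex.norm_ofNat, Complex.norm_real,
      Complex.norm_intCast, Real.norm_of_nonneg Real.pi_pos.le]
    nlinarith [Real.pi_gt_three]
  rw [fourierCoeffOn_of_hasDerivAt hab hn hfd (hd1.continuous.intervalIntegrable _ _),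
    fourierCoeffOn_of_hasDerivAt hab hn hfd' (hc2.intervalIntegrable _ _), hper, sub_self,
    mul_zero, zero_sub, norm_mul, norm_neg, norm_mul, norm_mul, hba]
  have hlast : ‖fourier (-n) (a : AddCircle (b - a)) * (deriv f b - deriv f a)
      - (b - a) * fourierCoeffOn hab (deriv (deriv f)) n‖
        ≤ ‖deriv f b - deriv f a‖ + (b - a) * C := by
    refine (norm_sub_le _ _).trans ?_
    rw [norm_mul, norm_mul, hba, fourier_apply, Circle.norm_coe, one_mul]
    gcongr
    exact hbd n
  calc _ ≤ 1 / |(n : ℝ)| * ((b - a) * (1 / |(n : ℝ)|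
        * (‖deriv f b - deriv f a‖ + (b - a) * C))) := by gcongr
    _ = D * (1 / (n : ℝ) ^ 2) := by
      rw [← sq_abs (n : ℝ)]; simp only [D]; field_simp

/-- Between the endpoints the odd power changes sign, and so does `e^{iθ/2}`, which is `∓i` at `θ =
∓π`. -/
theorem symbol_odd_periodic {n : ℕ} (hn : Odd n) :
    symbol n (1 / 2) (-(1 / 2)) = symbol n (1 / 2) (-(1 / 2) + 1) := by
  have h1 : (2 * Real.pi * Complex.I * ((-(1 / 2) : ℝ) : ℂ)) = -(Real.pi * Complex.I) := by
    push_cast; ring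
  have h2 : (2 * Real.pi * Complex.I * ((-(1 / 2) + 1 : ℝ) : ℂ)) = Real.pi * Complex.I := by
    push_cast; ring
  have h3 : (2 * Real.pi * Complex.I * ((1 / 2 : ℝ) : ℂ) * ((-(1 / 2) : ℝ) : ℂ))
      = -(Real.pi / 2 * Complex.I) := by push_cast; ring
  have h4 : (2 * Real.pi * Complex.I * ((1 / 2 : ℝ) : ℂ) * ((-(1 / 2) + 1 : ℝ) : ℂ))
      = Real.pi / 2 * Complex.I := by push_cast; ring
  rw [symbol, symbol, h1, h2, h3, h4, hn.neg_pow, Complex.exp_neg, Complex.exp_pi_div_two_mul_I,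
    Complex.inv_I]
  ring

theorem symbol_even_periodic {n : ℕ} (hn : Even n) :
    symbol n 0 (-(1 / 2)) = symbol n 0 (-(1 / 2) + 1) := by
  have h : (2 * Real.pi * Complex.I * ((-(1 / 2) + 1 : ℝ) : ℂ)) =
    -(2 * Real.pi * Complex.I * ((-(1 / 2) : ℝ) : ℂ)) := by push_cast; ring
  rw [symbol, symbol, h, hn.neg_pow]
  simp

/-! ### The series for the operator, by the continuous functional calculus -/

/-- The periodic extension of a symbol as a continuous function on the circle. -/
def symbolCircle (n : ℕ) (c : ℝ) (h : symbol n c (-(1 / 2)) = symbol n c (-(1 / 2) + 1)) :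
    C(AddCircle (1 : ℝ), ℂ) :=
  ⟨AddCircle.liftIco (1 : ℝ) (-(1 / 2)) (symbol n c),
    AddCircle.liftIco_continuous h (contDiff_symbol n c (m := 0)).continuous.continuousOn⟩

theorem hasSum_symbolCircle (n : ℕ) (c : ℝ)
    (h : symbol n c (-(1 / 2)) = symbol n c (-(1 / 2) + 1)) :
    HasSum (fun k : ℤ => ((iteratedDeriv n nsinc (c - k) : ℝ) : ℂ) • fourier k)
      (symbolCircle n c h) := by
  have hcoef : fourierCoeff (symbolCircle n c h)
      = fun k : ℤ => ((iteratedDeriv n nsinc (c - k) : ℝ) : ℂ) :=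
    funext (fourierCoeff_liftIco_symbol n c)
  have hsum : Summable (fourierCoeff (symbolCircle n c h)) := by
    have h1 := summable_fourierCoeffOn_of_contDiff
      (lt_add_of_pos_right (-(1 / 2) : ℝ) one_pos) (contDiff_symbol n c) h
    convert h1 using 1
    funext k
    exact fourierCoeff_liftIco_eq (T := (1 : ℝ)) (symbol n c) k
  simpa only [hcoef] using hasSum_fourier_series_of_summable hsum

theorem symbolCircle_coe {n : ℕ} {c : ℝ}
    (h : symbol n c (-(1 / 2)) = symbol n c (-(1 / 2) + 1)) {u : ℝ} (hu : |u| ≤ 1 / 2) :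
    symbolCircle n c h (u : AddCircle (1 : ℝ)) = symbol n c u := by
  rw [abs_le] at hu
  change AddCircle.liftIco (1 : ℝ) (-(1 / 2)) (symbol n c) u = _
  -- The lift uses the half-open interval, while `iπ` is not excluded from the spectrum: at `u =
  -- 1/2` the circle point is that of `-1/2`, and `h` matches the values.
  rcases eq_or_lt_of_le hu.2 with h1 | h1
  · have h2 : (u : AddCircle (1 : ℝ)) = ((-(1 / 2) : ℝ) : AddCircle (1 : ℝ)) := by
      rw [h1, ← AddCircle.coe_add_period 1 (-(1 / 2))]
      norm_num
    rw [h2, AddCircle.liftIco_coe_apply (by simp), h, h1]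
    norm_num
  · exact AddCircle.liftIco_coe_apply ⟨hu.1, by linarith⟩

/-- The map `iθ ↦ θ / 2π` from the spectrum of `H` to the circle. -/
def spectrumToCircle : C(spectrum ℂ H, AddCircle (1 : ℝ)) :=
  ⟨fun z => (((z : ℂ).im / (2 * Real.pi) : ℝ) : AddCircle (1 : ℝ)),
    (AddCircle.continuous_mk' 1).comp
      ((Complex.continuous_im.comp continuous_subtype_val).div_const _)⟩

theorem two_pi_I_mul_of_mem_spectrum_H {z : ℂ} (hz : z ∈ spectrum ℂ H) :
    2 * Real.pi * Complex.I * ((z.im / (2 * Real.pi) : ℝ) : ℂ) = z := by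
  have hpi : (Real.pi : ℂ) ≠ 0 := by exact_mod_cast Real.pi_ne_zero
  have hre := (exists_of_mem_spectrum_H hz).1
  have h1 : z = z.im * Complex.I := by
    apply Complex.ext <;> simp [hre]
  conv_rhs => rw [h1]
  push_cast
  field_simp

/-- This identifies the exponential power series with a functional calculus, so that scalar
identities for `e^{tz}` transfer to `expH`. -/
theorem cfc_cexp_mul (t : ℝ) : cfc (fun z : ℂ => Complex.exp (t * z)) H = expH t := by
  have h := cfc_comp_smul (t : ℂ) Complex.exp H
    Complex.continuous_exp.continuousOn isStarNormal_H
  simp only [smul_eq_mul] at h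
  rw [h, expH, CFC.complex_exp_eq_normedSpace_exp]

theorem expH_add (s t : ℝ) : expH (s + t) = expH s * expH t := by
  rw [← cfc_cexp_mul, ← cfc_cexp_mul, ← cfc_cexp_mul,
    ← cfc_mul _ _ H (by fun_prop) (by fun_prop)]
  simp only [Complex.ofReal_add, add_mul, Complex.exp_add]

theorem expH_zero : expH 0 = 1 := by simp [expH]

theorem cfcHom_fourier (k : ℤ) :
    cfcHom isStarNormal_H ((fourier k).comp spectrumToCircle) = expH k := by
  rw [← cfc_cexp_mul, cfc_apply (fun z : ℂ => Complex.exp ((k : ℝ) * z)) H isStarNormal_H]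
  congr 1
  ext z
  change fourier k (((z : ℂ).im / (2 * Real.pi) : ℝ) : AddCircle (1 : ℝ)) = Complex.exp _
  rw [fourier_coe_apply]
  conv_rhs => rw [← two_pi_I_mul_of_mem_spectrum_H z.2]
  congr 1
  push_cast
  ring

theorem cfcHom_symbolCircle (n : ℕ) (c : ℝ)
    (h : symbol n c (-(1 / 2)) = symbol n c (-(1 / 2) + 1)) :
    cfcHom isStarNormal_H ((symbolCircle n c h).comp spectrumToCircle) = H ^ n * expH c := by
  rw [← cfc_cexp_mul, ← cfc_pow_id (R := ℂ) H n isStarNormal_H,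
    ← cfc_mul _ _ H (by fun_prop) (by fun_prop),
    cfc_apply (fun z : ℂ => z ^ n * Complex.exp (c * z)) H isStarNormal_H]
  congr 1
  ext z
  change symbolCircle n c h (((z : ℂ).im / (2 * Real.pi) : ℝ) : AddCircle (1 : ℝ)) =
    (z : ℂ) ^ n * Complex.exp (c * z)
  have hz := two_pi_I_mul_of_mem_spectrum_H z.2
  rw [symbolCircle_coe, symbol, hz]
  · congr 2
    conv_rhs => rw [← hz]
    ring
  · rw [abs_div, abs_of_pos Real.two_pi_pos, div_le_iff₀ Real.two_pi_pos]
    linarith [(exists_of_mem_spectrum_H z.2).2]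

/-- The Fourier series converges uniformly on the circle; pulling back to the spectrum and applying
the continuous map `cfcHom` gives convergence in operator norm, and evaluation at `a` gives it in
`l²`. -/
theorem hasSum_expH (n : ℕ) (c : ℝ)
    (h : symbol n c (-(1 / 2)) = symbol n c (-(1 / 2) + 1)) (a : SeqL2) :
    HasSum (fun k : ℤ => ((iteratedDeriv n nsinc (c - k) : ℝ) : ℂ) • expH (k - c) a)
      ((H ^ n) a) := by
  have h1 := (((hasSum_symbolCircle n c h).map
    (ContinuousMap.compRightAlgHom ℂ ℂ spectrumToCircle)
    (ContinuousMap.continuous_precomp spectrumToCircle)).map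
    (cfcHom (R := ℂ) isStarNormal_H) (cfcHom_continuous isStarNormal_H)).mul_right (expH (-c))
  have h2 : cfcHom (R := ℂ) isStarNormal_H (ContinuousMap.compRightAlgHom ℂ ℂ spectrumToCircle
      (symbolCircle n c h)) * expH (-c) = H ^ n := by
    change cfcHom (R := ℂ) isStarNormal_H ((symbolCircle n c h).comp spectrumToCircle) * _ = _
    rw [cfcHom_symbolCircle, mul_assoc, ← expH_add, add_neg_cancel, expH_zero, mul_one]
  rw [h2] at h1
  convert h1.mapL (ContinuousLinearMap.apply ℂ SeqL2 a) using 2 with k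
  · simp only [Function.comp_apply, map_smul, smul_mul_assoc]
    change _ = _ • (cfcHom (R := ℂ) isStarNormal_H ((fourier k).comp spectrumToCircle)
      * expH (-c)) a
    rw [cfcHom_fourier, ← expH_add, ← sub_eq_add_neg (k : ℝ) c]
  · rfl

/-! ### Matching the coefficients with derivatives of the cardinal sine -/

theorem neg_one_zpow_mul_coeffA (s : ℕ) (k : ℤ) :
    (-1 : ℝ) ^ (k + 1) * coeffA s k = iteratedDeriv (2 * s - 1) nsinc (1 / 2 - k) := by
  rw [coeffA, ← mul_assoc, ← mul_zpow]
  norm_num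

/-- The integral of `(2πiu)^{2s}` over `[-1/2, 1/2]`. It shows that the separately defined `B_{s,0}`
follows the same rule as the other coefficients. -/
theorem iteratedDeriv_nsinc_zero (s : ℕ) :
    iteratedDeriv (2 * s) nsinc 0 = (-1 : ℝ) ^ s * (Real.pi ^ (2 * s) / (2 * (s : ℝ) + 1)) := by
  apply Complex.ofReal_injective
  rw [ofReal_iteratedDeriv_nsinc]
  have h1 : ∀ u : ℝ, (2 * Real.pi * Complex.I * u) ^ (2 * s)
      * Complex.exp (2 * Real.pi * Complex.I * (0 : ℝ) * u)
      = ((((-1) ^ s * (2 * Real.pi) ^ (2 * s)) * u ^ (2 * s) : ℝ) : ℂ) := by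
    intro u
    simp only [Complex.ofReal_zero, mul_zero, zero_mul, Complex.exp_zero, mul_one]
    rw [mul_pow, mul_pow, pow_mul Complex.I, Complex.I_sq]
    push_cast
    ring
  rw [funext h1, intervalIntegral.integral_ofReal, intervalIntegral.integral_const_mul,
    integral_pow]
  congr 1
  have h2 : (-(1 / 2) : ℝ) ^ (2 * s + 1) = -(1 / 2) ^ (2 * s + 1) :=
    Odd.neg_pow ⟨s, rfl⟩ _
  rw [h2, mul_pow]
  push_cast
  field_simp
  have h3 : (2 : ℝ) ^ (2 * s) * (1 / 2) ^ (2 * s) = 1 := by rw [← mul_pow]; norm_num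
  rw [pow_succ]
  linear_combination h3

theorem neg_one_zpow_mul_coeffB (s : ℕ) (k : ℤ) :
    (-1 : ℝ) ^ (k + 1) * coeffB s k = iteratedDeriv (2 * s) nsinc (0 - k) := by
  rw [coeffB, zero_sub]
  split_ifs with hk
  · subst hk
    rw [Int.cast_zero, neg_zero, iteratedDeriv_nsinc_zero, ← mul_assoc, zero_add, zpow_one, pow_succ]
    ring
  · rw [← mul_assoc, ← mul_zpow]
    norm_num

theorem hasSum_oddTerm {s : ℕ} (hs : 1 ≤ s) (a : SeqL2) :
    HasSum (oddTerm s a) ((H ^ (2 * s - 1)) a) := by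
  have h := hasSum_expH (2 * s - 1) (1 / 2) (symbol_odd_periodic ⟨s - 1, by omega⟩) a
  have h2 : oddTerm s a = fun k : ℤ =>
      ((iteratedDeriv (2 * s - 1) nsinc (1 / 2 - k) : ℝ) : ℂ) • expH (k - 1 / 2) a := by
    funext k
    rw [oddTerm, neg_one_zpow_mul_coeffA]
  rwa [h2]

theorem hasSum_evenTerm (s : ℕ) (a : SeqL2) :
    HasSum (evenTerm s a) ((H ^ (2 * s)) a) := by
  have h := hasSum_expH (2 * s) 0 (symbol_even_periodic (even_two_mul s)) a
  have h2 : evenTerm s a = fun k : ℤ =>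
      ((iteratedDeriv (2 * s) nsinc (0 - k) : ℝ) : ℂ) • expH (k - 0) a := by
    funext k
    rw [evenTerm, neg_one_zpow_mul_coeffB, sub_zero]
  rwa [h2]

theorem boasR_eq {r : ℕ} (a : SeqL2) : boasR r a = (H ^ r) a := by
  rw [boasR]
  split_ifs with h
  · obtain ⟨m, rfl⟩ := h
    have h1 := (hasSum_oddTerm (s := m + 1) (by omega) a).tsum_eq
    rwa [show (2 * m + 1 + 1) / 2 = m + 1 by omega,
      show 2 * m + 1 = 2 * (m + 1) - 1 by omega]
  · obtain ⟨m, rfl⟩ := (Nat.not_odd_iff_even.1 h).two_dvd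
    have h1 := (hasSum_evenTerm m a).tsum_eq
    rwa [Nat.mul_div_cancel_left m two_pos]

end DiscreteHilbert
end

open DiscreteHilbert in
theorem mainTheorem12 :
    (∀ s : ℕ, 1 ≤ s → ∀ a : SeqL2, HasSum (oddTerm s a) ((H ^ (2 * s - 1)) a)) ∧
    (∀ s : ℕ, 1 ≤ s → ∀ a : SeqL2, HasSum (evenTerm s a) ((H ^ (2 * s)) a)) ∧
    (∀ r : ℕ, 1 ≤ r → ∀ a : SeqL2,
      (H ^ r) a = boasR r a ∧ boasR r a = (boasR 1)^[r] a) := by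
  refine ⟨fun s hs a => hasSum_oddTerm hs a, fun s _ a => hasSum_evenTerm s a,
    fun r _ a => ⟨(boasR_eq a).symm, ?_⟩⟩
  have h1 : boasR 1 = H := by
    funext b
    rw [boasR_eq, pow_one]
  rw [boasR_eq, h1]
  exact Module.End.pow_apply (H : SeqL2 →ₗ[ℂ] SeqL2) r a ▸
    congrArg (fun T : SeqL2 →ₗ[ℂ] SeqL2 => T a) (ContinuousLinearMap.toLinearMap_pow H r)
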